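/- Let $F$ be a field of characteristic different from $2$, and let $L/F$ be a finite Galois extension whose Galois group $G=\mathrm{Gal}(L/F)$ is isomorphic to the quaternion group $Q_8$ of order $8$. For $x,y\in F^\times$ let $(x,y)_F$ denote the quaternion algebra with $F$-basis $1,u,v,w$ and relations $u^2=x$, $v^2=y$, $uv=w=-vu$. (1) Let $K$ be the biquadratic subextension of $L/F$ (the intermediate field that is Galois over $F$ with $\mathrm{Gal}(K/F)\cong C_2\times C_2$), and suppose $K=F(\alpha,\beta)$ with $\alpha^2=a\in F$ and $\beta^2=b\in F$. Then $(-a,-b)_F\cong(-1,-1)_F$ as $F$-algebras. (2) Let $\lambda,\rho:G\to\mathrm{Perm}(G)$ be the left and right regular representations, $\lambda(g)[x]=gx$ and $\rho(g)[x]=xg^{-1}$. For $N=\lambda(G)$ or $N=\rho(G)$ let $G$ act on the group algebra $L[N]$ through the Galois action on $L$ and through $\eta\mapsto\lambda(g)\eta\lambda(g)^{-1}$ on $N$, and let $L[N]^G$ be the fixed ring, an $F$-algebra. Then $$L[\rho(G)]^G\;\cong\; L[\lambda(G)]^G\;\cong\; F^4\times(-1,-1)_F$$ as $F$-algebras. 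-/

import Mathlib

open scoped Quaternion

/-- The left regular representation `λ : G → Perm(G)`, `λ(g)[x] = g x`. -/
def leftReg (G : Type*) [Group G] : G →* Equiv.Perm G where
  toFun g := Equiv.mulLeft g
  map_one' := by ext x; simp
  map_mul' g h := by ext x; simp

/-- The right regular representation `ρ : G → Perm(G)`, `ρ(g)[x] = x g⁻¹`. -/
def rightReg (G : Type*) [Group G] : G →* Equiv.Perm G where
  toFun g := Equiv.mulRight g⁻¹
  map_one' := by ext x; simp
  map_mul' g h := by ext x; simp [mul_assoc]

/-- `λ(g)` and `ρ(h)` commute in `Perm(G)`. -/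
theorem leftReg_mul_rightReg (G : Type*) [Group G] (g h : G) :
    leftReg G g * rightReg G h = rightReg G h * leftReg G g := by
  ext x; simp [leftReg, rightReg, mul_assoc]

/-- `λ(G)` is normalised by `λ(G)`. -/
theorem leftReg_normalised (G : Type*) [Group G] :
    (leftReg G).range ≤ Subgroup.normalizer ((leftReg G).range : Set (Equiv.Perm G)) :=
  Subgroup.le_normalizer

/-- `ρ(G)` is normalised by `λ(G)`. -/
theorem rightReg_normalised (G : Type*) [Group G] :
    (leftReg G).range ≤ Subgroup.normalizer ((rightReg G).range : Set (Equiv.Perm G)) := by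
  rintro _ ⟨g, rfl⟩
  rw [Subgroup.mem_normalizer_iff]
  intro n
  constructor
  · rintro ⟨h, rfl⟩
    rw [leftReg_mul_rightReg, mul_assoc, mul_inv_cancel, mul_one]
    exact ⟨h, rfl⟩
  · rintro ⟨h, hh⟩
    refine ⟨h, ?_⟩
    have h1 : n = (leftReg G g)⁻¹ * rightReg G h * leftReg G g := by
      rw [hh]; group
    rw [h1, mul_assoc, ← leftReg_mul_rightReg, ← mul_assoc, inv_mul_cancel, one_mul]

/-- For a subgroup `N` of `Perm(G)` normalised by `λ(G)`, the action of `g ∈ G` on `N`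
by the group automorphism `η ↦ λ(g) η λ(g)⁻¹`. -/
def conjAct {G : Type*} [Group G] (N : Subgroup (Equiv.Perm G))
    (hN : (leftReg G).range ≤ Subgroup.normalizer (N : Set (Equiv.Perm G))) (g : G) : N ≃* N :=
  N.normalizerMonoidHom ⟨leftReg G g, hN ⟨g, rfl⟩⟩

theorem coe_conjAct {G : Type*} [Group G] (N : Subgroup (Equiv.Perm G))
    (hN : (leftReg G).range ≤ Subgroup.normalizer (N : Set (Equiv.Perm G))) (g : G) (η : N) :
    (conjAct N hN g η : Equiv.Perm G) = leftReg G g * η * (leftReg G g)⁻¹ := rfl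

/-- The action of `g ∈ G = Gal(L/F)` on the group algebra `L[N]`: on `L` as a Galois automorphism
and on `N` by conjugation by `λ(g)`. -/
noncomputable def galAct (F L : Type*) [Field F] [Field L] [Algebra F L]
    (N : Subgroup (Equiv.Perm Gal(L/F)))
    (hN : (leftReg Gal(L/F)).range ≤ Subgroup.normalizer (N : Set (Equiv.Perm Gal(L/F))))
    (g : Gal(L/F)) : MonoidAlgebra L N →ₐ[F] MonoidAlgebra L N :=
  (MonoidAlgebra.mapDomainAlgHom F L (conjAct N hN g).toMonoidHom).comp
    (MonoidAlgebra.mapAlgHom N (g : L →ₐ[F] L))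

theorem galAct_single (F L : Type*) [Field F] [Field L] [Algebra F L]
    (N : Subgroup (Equiv.Perm Gal(L/F)))
    (hN : (leftReg Gal(L/F)).range ≤ Subgroup.normalizer (N : Set (Equiv.Perm Gal(L/F))))
    (g : Gal(L/F)) (c : L) (η : N) :
    galAct F L N hN g (MonoidAlgebra.single η c) =
      MonoidAlgebra.single (conjAct N hN g η) (g c) := by
  simp [galAct]

/-- The `F`-algebra `L[N]^G` (`G = Gal(L/F)`), the fixed ring of the group algebra `L[N]` for a
subgroup `N` of `Perm(G)` normalised by `λ(G)`. -/
noncomputable def fixedGroupAlgebra (F L : Type*) [Field F] [Field L] [Algebra F L]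
    (N : Subgroup (Equiv.Perm Gal(L/F)))
    (hN : (leftReg Gal(L/F)).range ≤ Subgroup.normalizer (N : Set (Equiv.Perm Gal(L/F)))) :
    Subalgebra F (MonoidAlgebra L N) :=
  ⨅ g : Gal(L/F), AlgHom.equalizer (galAct F L N hN g) (AlgHom.id F (MonoidAlgebra L N))

theorem mem_fixedGroupAlgebra (F L : Type*) [Field F] [Field L] [Algebra F L]
    (N : Subgroup (Equiv.Perm Gal(L/F)))
    (hN : (leftReg Gal(L/F)).range ≤ Subgroup.normalizer (N : Set (Equiv.Perm Gal(L/F))))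
    (x : MonoidAlgebra L N) :
    x ∈ fixedGroupAlgebra F L N hN ↔ ∀ g : Gal(L/F), galAct F L N hN g x = x := by
  simp [fixedGroupAlgebra, Algebra.mem_iInf, AlgHom.mem_equalizer]

/-- `L[λ(G)]^G`, `G = Gal(L/F)`. -/
noncomputable abbrev lambdaAlgebra (F L : Type*) [Field F] [Field L] [Algebra F L] :
    Subalgebra F (MonoidAlgebra L (leftReg Gal(L/F)).range) :=
  fixedGroupAlgebra F L (leftReg Gal(L/F)).range (leftReg_normalised Gal(L/F))

/-- `L[ρ(G)]^G`, `G = Gal(L/F)`. -/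
noncomputable abbrev rhoAlgebra (F L : Type*) [Field F] [Field L] [Algebra F L] :
    Subalgebra F (MonoidAlgebra L (rightReg Gal(L/F)).range) :=
  fixedGroupAlgebra F L (rightReg Gal(L/F)).range (rightReg_normalised Gal(L/F))

/-! `λ` and `ρ` commute, so on `L[ρ(G)]` only coefficients move and the fixed ring is `F[ρ(G)]`. On
`L[λ(G)]` the action of `g` is the coefficient action followed by conjugation by `λ(g)`. A normal
basis gives a unit `c` with `g(c) = c λ(g)`, and conjugation by `c` carries the fixed ring onto
`F[λ(G)]` (`exists_lambdaAlgebra_equiv`). Both fixed rings are thus `F[Q₈]`, which splits as `F⁴ ×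
(-1,-1)` since `2` is invertible.

For (1), let `z` be the central involution and let `s`, `t` generate `G`, with `s` fixing only `α`
and `t` only `β`. Then `α(1 - z)s` and `β(1 - z)t` are fixed and anticommute. In the `(-1,-1)`
quotient, where `z` becomes `-1`, their halves square to `-a` and `-b`. The resulting map `(-a,-b) →
(-1,-1)` is injective between spaces of dimension four. -/

/-! ### Galois descent for group algebras and the normal basis unit -/

namespace MonoidAlgebra

/-- Extension of scalars `F[N] → L[N]`. -/
noncomputable def baseChange (F L N : Type*) [Field F] [Field L] [Algebra F L] [Group N] :
    MonoidAlgebra F N →ₐ[F] MonoidAlgebra L N :=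
  mapAlgHom N (Algebra.ofId F L)

section

variable {F L N : Type*} [Field F] [Field L] [Algebra F L] [Group N]

theorem coeff_baseChange (x : MonoidAlgebra F N) (n : N) :
    (baseChange F L N x).coeff n = algebraMap F L (x.coeff n) := by
  simp [baseChange, Algebra.ofId_apply]

theorem baseChange_single (n : N) (r : F) :
    baseChange F L N (single n r) = single n (algebraMap F L r) := by
  simp [baseChange, Algebra.ofId_apply]

theorem baseChange_injective : Function.Injective (baseChange F L N) := by
  intro x y h
  ext n
  apply (algebraMap F L).injective
  rw [← coeff_baseChange, ← coeff_baseChange, h]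

theorem mem_range_baseChange_iff [FiniteDimensional F L] [IsGalois F L]
    (x : MonoidAlgebra L N) :
    x ∈ (baseChange F L N).range ↔ ∀ g : Gal(L/F), mapAlgHom N (g : L →ₐ[F] L) x = x := by
  constructor
  · rintro ⟨y, rfl⟩ g
    ext n
    simp [coeff_baseChange]
  · intro h
    have h1 : x ∈ Set.range (map (M := N) (algebraMap F L).toAddMonoidHom) := by
      rw [range_map]
      intro n
      have := (IsGalois.mem_range_algebraMap_iff_fixed (F := F) (x.coeff n)).2 fun g => by
        have := congrArg (fun y => y.coeff n) (h g)
        simpa using this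
      simpa using this
    obtain ⟨y, rfl⟩ := h1
    refine ⟨y, ?_⟩
    ext n
    simp [coeff_baseChange]

theorem commute_single_of_mem_center {R : Type*} [CommSemiring R] {n : N}
    (hn : n ∈ Subgroup.center N) (x : MonoidAlgebra R N) : Commute (single n (1 : R)) x := by
  have := of_commute (R := R) (m := n) (fun m => (Subgroup.mem_center_iff.1 hn m).symm) x
  simpa using this

/-- The unit of `L[N]` built from a normal basis of `L/F`. -/
theorem exists_unit_map_eq_mul_single [FiniteDimensional F L] [IsGalois F L]
    (e : Gal(L/F) ≃* N) :
    ∃ c : (MonoidAlgebra L N)ˣ, ∀ g : Gal(L/F),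
      mapAlgHom N (g : L →ₐ[F] L) (c : MonoidAlgebra L N) =
        (c : MonoidAlgebra L N) * single (e g) 1 := by
  classical
  have : Finite N := Finite.of_equiv _ e.toEquiv
  have : Fintype N := Fintype.ofFinite N
  let θ := IsGalois.normalBasis F L 1
  -- The inverse in `e g⁻¹` turns the reindexing `h ↦ g * h` into right multiplication by `e g`.
  let c : MonoidAlgebra L N := ∑ g : Gal(L/F), single (e g⁻¹) (g θ)
  have hc : ∀ g : Gal(L/F), mapAlgHom N (g : L →ₐ[F] L) c = c * single (e g) 1 := by
    intro g
    simp only [c, map_sum, Finset.sum_mul, mapAlgHom_single, single_mul_single, mul_one]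
    refine Fintype.sum_equiv (Equiv.mulLeft g) _ _ fun h => ?_
    simp [← map_mul]
  have hinj : Function.Injective (LinearMap.mulLeft L c) := by
    rw [← LinearMap.ker_eq_bot, LinearMap.ker_eq_bot']
    intro y hy
    -- The coefficient of `c * y` at `e r⁻¹`. As `r θ` runs over a basis, the `L`-combination of
    -- automorphisms vanishes, and Dedekind independence gives `y = 0`.
    have h1 : ∀ r : Gal(L/F), ∑ t : Gal(L/F), y.coeff (e t) * t (r θ) = 0 := by
      intro r
      have h2 := congrArg (fun z => z.coeff (e r⁻¹)) hy
      simp only [LinearMap.mulLeft_apply, c, Finset.sum_mul, coeff_zero, Finsupp.coe_zero,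
        Pi.zero_apply, coeff_sum, Finsupp.finsetSum_apply, coeff_single_mul_apply] at h2
      rw [← h2]
      refine Fintype.sum_equiv (Equiv.mulRight r) _ _ fun t => ?_
      simp [mul_comm, ← map_inv, ← map_mul]
    have h2 : ∑ t : Gal(L/F), y.coeff (e t) • (t : L →ₐ[F] L).toLinearMap = 0 := by
      refine (IsGalois.normalBasis F L).ext fun r => ?_
      rw [IsGalois.normalBasis_apply]
      simpa using h1 r
    have h3 := Fintype.linearIndependent_iff.1
      ((linearIndependent_toLinearMap F L L).comp (fun t : Gal(L/F) => (t : L →ₐ[F] L))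
        AlgEquiv.coe_toAlgHom_injective) (fun t => y.coeff (e t)) h2
    ext n
    simpa using h3 (e.symm n)
  have hfin : FiniteDimensional L (MonoidAlgebra L N) := inferInstance
  obtain ⟨d, hd⟩ := (LinearMap.injective_iff_surjective.1 hinj) 1
  have hd : c * d = 1 := hd
  exact ⟨⟨c, d, hd, hinj (by simp [← mul_assoc, hd])⟩, hc⟩

end

end MonoidAlgebra

/-! ### The fixed rings for `ρ(G)` and `λ(G)` -/

open MonoidAlgebra

section

variable (F L : Type*) [Field F] [Field L] [Algebra F L]

theorem rhoAlgebra_eq_range [FiniteDimensional F L] [IsGalois F L] :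
    rhoAlgebra F L = (baseChange F L (rightReg Gal(L/F)).range).range := by
  ext x
  rw [mem_range_baseChange_iff, mem_fixedGroupAlgebra]
  refine forall_congr' fun g => ?_
  have : conjAct (rightReg Gal(L/F)).range (rightReg_normalised _) g = MulEquiv.refl _ := by
    ext1 ⟨_, h, rfl⟩
    apply Subtype.ext
    simp [coe_conjAct, leftReg_mul_rightReg]
  simp [galAct, this, mapDomainAlgHom]

variable {F L}

theorem leftReg_injective (G : Type*) [Group G] : Function.Injective (leftReg G) := fun g h H => by
  simpa [leftReg] using congrArg (fun f => f 1) H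

theorem rightReg_injective (G : Type*) [Group G] : Function.Injective (rightReg G) :=
  fun g h H => by simpa [rightReg] using congrArg (fun f => f 1) H

/-- The isomorphism `G ≃ λ(G)`. -/
noncomputable def leftRegEquiv (G : Type*) [Group G] : G ≃* (leftReg G).range :=
  MonoidHom.ofInjective (leftReg_injective G)

/-- The isomorphism `G ≃ ρ(G)`. -/
noncomputable def rightRegEquiv (G : Type*) [Group G] : G ≃* (rightReg G).range :=
  MonoidHom.ofInjective (rightReg_injective G)

theorem coe_leftRegEquiv {G : Type*} [Group G] (g : G) :
    (leftRegEquiv G g : Equiv.Perm G) = leftReg G g := rfl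

theorem conjAct_leftRegEquiv (g h : Gal(L/F)) :
    conjAct (leftReg Gal(L/F)).range (leftReg_normalised _) g (leftRegEquiv _ h) =
      leftRegEquiv _ (g * h * g⁻¹) := by
  apply Subtype.ext
  simp [coe_conjAct, coe_leftRegEquiv]

theorem galAct_left (g : Gal(L/F)) (x : MonoidAlgebra L (leftReg Gal(L/F)).range) :
    galAct F L _ (leftReg_normalised _) g x =
      single (leftRegEquiv _ g) 1 * mapAlgHom _ (g : L →ₐ[F] L) x *
        single (leftRegEquiv _ g)⁻¹ 1 := by
  induction x using MonoidAlgebra.induction_linear with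
  | zero => simp
  | add f g hf hg => simp only [map_add, hf, hg, mul_add, add_mul]
  | single n r =>
    obtain ⟨h, rfl⟩ := (leftRegEquiv _).surjective n
    simp [galAct_single, conjAct_leftRegEquiv, single_mul_single]

/-- A normal basis identifies `L[λ(G)]^G` with `F[λ(G)]` through an inner automorphism of
`L[λ(G)]`. -/
theorem exists_lambdaAlgebra_equiv [FiniteDimensional F L] [IsGalois F L] :
    ∃ (Φ : lambdaAlgebra F L ≃ₐ[F] MonoidAlgebra F (leftReg Gal(L/F)).range)
      (c : (MonoidAlgebra L (leftReg Gal(L/F)).range)ˣ),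
      ∀ x, baseChange F L _ (Φ x) = c.val * x * c⁻¹.val := by
  obtain ⟨c, hc⟩ := exists_unit_map_eq_mul_single (leftRegEquiv Gal(L/F))
  let γ : MonoidAlgebra L (leftReg Gal(L/F)).range ≃ₐ[F] MonoidAlgebra L (leftReg Gal(L/F)).range :=
    MulSemiringAction.toAlgEquiv F _ (ConjAct.toConjAct c)
  have hγ : ∀ x, γ x = c.val * x * c⁻¹.val := fun x => rfl
  have hc' : ∀ g : Gal(L/F), mapAlgHom _ (g : L →ₐ[F] L)
      c⁻¹.val =
      single (leftRegEquiv _ g)⁻¹ 1 * c⁻¹.val := by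
    intro g
    refine left_inv_eq_right_inv (a := mapAlgHom _ (g : L →ₐ[F] L) (c : MonoidAlgebra L _)) ?_ ?_
    · rw [← map_mul, Units.inv_mul, map_one]
    · rw [hc, mul_assoc, ← mul_assoc (single _ _), single_mul_single]
      simp [← one_def]
  have hmap : (lambdaAlgebra F L).map γ.toAlgHom = (baseChange F L (leftReg Gal(L/F)).range).range := by
    have key : ∀ x, γ x ∈ (baseChange F L (leftReg Gal(L/F)).range).range ↔ x ∈ lambdaAlgebra F L := by
      intro x
      rw [mem_range_baseChange_iff, mem_fixedGroupAlgebra]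
      refine forall_congr' fun g => ?_
      rw [← γ.injective.eq_iff (b := x), galAct_left, hγ, hγ, map_mul, map_mul, hc, hc']
      simp only [mul_assoc]
    ext y
    rw [Subalgebra.mem_map]
    constructor
    · rintro ⟨x, hx, rfl⟩
      exact (key x).2 hx
    · intro hy
      exact ⟨γ.symm y, (key _).1 (by rwa [γ.apply_symm_apply]), γ.apply_symm_apply y⟩
  let Φ₀ := AlgEquiv.ofInjective (baseChange F L (leftReg Gal(L/F)).range) baseChange_injective
  let Φ := (γ.subalgebraMap (lambdaAlgebra F L)).trans
    ((Subalgebra.equivOfEq _ _ hmap).trans Φ₀.symm)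
  refine ⟨Φ, c, fun x => ?_⟩
  have : Φ₀ (Φ x) = Subalgebra.equivOfEq _ _ hmap (γ.subalgebraMap (lambdaAlgebra F L) x) := by
    simp [Φ]
  exact congrArg Subtype.val this

theorem nonempty_rhoAlgebra_equiv [FiniteDimensional F L] [IsGalois F L] :
    Nonempty (rhoAlgebra F L ≃ₐ[F] MonoidAlgebra F Gal(L/F)) :=
  ⟨(Subalgebra.equivOfEq _ _ (rhoAlgebra_eq_range F L)).trans <|
    (AlgEquiv.ofInjective (baseChange F L (rightReg Gal(L/F)).range) baseChange_injective).symm.trans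
      (domCongr F F (rightRegEquiv _).symm)⟩

end

/-! ### Homomorphisms between quaternion algebras -/

namespace QuaternionAlgebra

variable {F : Type*} [Field F]

/-- A homomorphism out of a nondegenerate quaternion algebra is injective. -/
theorem algHom_injective {A : Type*} [Ring A] [Nontrivial A] [Algebra F A] (h2 : (2 : F) ≠ 0)
    {a b : F} (ha : a ≠ 0) (hb : b ≠ 0) (f : ℍ[F,a,b] →ₐ[F] A) : Function.Injective f := by
  rw [injective_iff_map_eq_zero]
  have hre : ∀ x, f x = 0 → x.re = 0 := by
    intro x hx
    let i : ℍ[F,a,b] := ⟨0, 1, 0, 0⟩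
    let j : ℍ[F,a,b] := ⟨0, 0, 1, 0⟩
    -- `a x + i x i` kills the `j` and `k` parts and doubles the rest by `2a`; the same operation
    -- with `j` and `b` then leaves only the real part.
    have h1 : b • (a • x + i * x * i) + j * (a • x + i * x * i) * j =
        algebraMap F _ (2 * 2 * a * b * x.re) := by
      ext <;> simp [i, j, algebraMap_eq] <;> ring
    have h3 := congrArg f h1
    rw [AlgHom.commutes] at h3
    have h4 : algebraMap F A (2 * 2 * a * b * x.re) = 0 := by
      rw [← h3]
      simp only [map_add, map_mul, map_smul, hx]
      simp
    simpa [h2, ha, hb] using (map_eq_zero_iff _ (algebraMap F A).injective).1 h4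
  intro x hx
  -- Multiplying by `i`, `j`, `k` brings each remaining coordinate into the real part.
  have hmul : ∀ y : ℍ[F,a,b], (y * x).re = 0 := fun y => hre _ (by rw [map_mul, hx, mul_zero])
  ext
  · exact hre x hx
  · simpa [ha] using hmul ⟨0, 1, 0, 0⟩
  · simpa [hb] using hmul ⟨0, 0, 1, 0⟩
  · simpa [ha, hb] using hmul ⟨0, 0, 0, 1⟩

/-- Nondegenerate quaternion algebras are isomorphic once there is a homomorphism between them. -/
noncomputable def equivOfAlgHom (h2 : (2 : F) ≠ 0) {a b a' b' : F} (ha : a ≠ 0) (hb : b ≠ 0)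
    (f : ℍ[F,a,b] →ₐ[F] ℍ[F,a',b']) : ℍ[F,a,b] ≃ₐ[F] ℍ[F,a',b'] :=
  AlgEquiv.ofBijective f (by
    have h := algHom_injective h2 ha hb f
    refine ⟨h, (LinearMap.injective_iff_surjective_of_finrank_eq_finrank (f := f.toLinearMap) ?_).1 h⟩
    rw [finrank_eq_four, finrank_eq_four])

end QuaternionAlgebra

/-! ### The group algebra of `Q₈` -/

namespace QuaternionGroup

/-- The coordinates of the embedding of `Q₈` into the quaternions. -/
def quaternionCoord : QuaternionGroup 2 → Fin 4 → ℤ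
  | .a n => ![![1, 0, 0, 0], ![0, 1, 0, 0], ![-1, 0, 0, 0], ![0, -1, 0, 0]] n
  -- With `a 1 = i` and `xa 0 = j`, `xa 1 = xa 0 * a 1 = ji = -k`.
  | .xa n => ![![0, 0, 1, 0], ![0, 0, 0, -1], ![0, 0, -1, 0], ![0, 0, 0, 1]] n

theorem quaternionCoord_mul : ∀ x y : QuaternionGroup 2,
    letI p := quaternionCoord x
    letI q := quaternionCoord y
    quaternionCoord (x * y) =
      ![p 0 * q 0 - p 1 * q 1 - p 2 * q 2 - p 3 * q 3,
        p 0 * q 1 + p 1 * q 0 + p 2 * q 3 - p 3 * q 2,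
        p 0 * q 2 - p 1 * q 3 + p 2 * q 0 + p 3 * q 1,
        p 0 * q 3 + p 1 * q 2 - p 2 * q 1 + p 3 * q 0] := by
  decide

/-- The embedding of `Q₈` into the quaternions `(-1,-1)`. -/
def toQuaternion (F : Type*) [CommRing F] : QuaternionGroup 2 →* ℍ[F,-1,-1] where
  toFun x := ⟨quaternionCoord x 0, quaternionCoord x 1, quaternionCoord x 2, quaternionCoord x 3⟩
  map_one' := by
    rw [show quaternionCoord 1 = ![1, 0, 0, 0] by decide]
    ext <;> simp
  map_mul' x y := by ext <;> simp [quaternionCoord_mul] <;> ring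

/-- The four linear characters of `Q₈`, with integral values. -/
def linearCharInt : QuaternionGroup 2 →* (Fin 4 → ℤ) where
  toFun
    | .a n => ![1, ![1, -1, 1, -1] n, 1, ![1, -1, 1, -1] n]
    | .xa n => ![1, ![1, -1, 1, -1] n, -1, ![-1, 1, -1, 1] n]
  map_one' := by decide
  map_mul' := by decide

/-- The algebra homomorphism `F[Q₈] → F⁴ × (-1,-1)`. -/
noncomputable def algHomProd (F : Type*) [Field F] :
    MonoidAlgebra F (QuaternionGroup 2) →ₐ[F] (Fin 4 → F) × ℍ[F,-1,-1] :=
  MonoidAlgebra.lift F _ (QuaternionGroup 2)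
    ((((Int.castRingHom F).compLeft (Fin 4)).toMonoidHom.comp linearCharInt).prod (toQuaternion F))

theorem algHomProd_surjective {F : Type*} [Field F] (h2 : (2 : F) ≠ 0) :
    Function.Surjective (algHomProd F) := by
  rintro ⟨v, q⟩
  have h4 : (4 : F) ≠ 0 := by
    rw [show (4 : F) = 2 * 2 by norm_num]; exact mul_ne_zero h2 h2
  have h8 : (8 : F) ≠ 0 := by
    rw [show (8 : F) = 4 * 2 by norm_num]; exact mul_ne_zero h4 h2
  let s := MonoidAlgebra.single (R := F) (M := QuaternionGroup 2)
  -- Fourier inversion: a linear character has weight `1/8`, the two-dimensional one `2/8`, and its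
  -- trace doubles a coordinate, giving `1/2`.
  refine ⟨s (a 0) ((v 0 + v 1 + v 2 + v 3) / 8 + q.re / 2)
    + s (a 2) ((v 0 + v 1 + v 2 + v 3) / 8 - q.re / 2)
    + s (a 1) ((v 0 - v 1 + v 2 - v 3) / 8 + q.imI / 2)
    + s (a 3) ((v 0 - v 1 + v 2 - v 3) / 8 - q.imI / 2)
    + s (xa 0) ((v 0 + v 1 - v 2 - v 3) / 8 + q.imJ / 2)
    + s (xa 2) ((v 0 + v 1 - v 2 - v 3) / 8 - q.imJ / 2)
    + s (xa 3) ((v 0 - v 1 - v 2 + v 3) / 8 + q.imK / 2)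
    + s (xa 1) ((v 0 - v 1 - v 2 + v 3) / 8 - q.imK / 2), ?_⟩
  have c0 : linearCharInt (a 0) = ![1, 1, 1, 1] := by decide
  have c1 : linearCharInt (a 1) = ![1, -1, 1, -1] := by decide
  have c2 : linearCharInt (a 2) = ![1, 1, 1, 1] := by decide
  have c3 : linearCharInt (a 3) = ![1, -1, 1, -1] := by decide
  have d0 : linearCharInt (xa 0) = ![1, 1, -1, -1] := by decide
  have d1 : linearCharInt (xa 1) = ![1, -1, -1, 1] := by decide
  have d2 : linearCharInt (xa 2) = ![1, 1, -1, -1] := by decide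
  have d3 : linearCharInt (xa 3) = ![1, -1, -1, 1] := by decide
  have p0 : quaternionCoord (a 0) = ![1, 0, 0, 0] := by decide
  have p1 : quaternionCoord (a 1) = ![0, 1, 0, 0] := by decide
  have p2 : quaternionCoord (a 2) = ![-1, 0, 0, 0] := by decide
  have p3 : quaternionCoord (a 3) = ![0, -1, 0, 0] := by decide
  have q0 : quaternionCoord (xa 0) = ![0, 0, 1, 0] := by decide
  have q1 : quaternionCoord (xa 1) = ![0, 0, 0, -1] := by decide
  have q2 : quaternionCoord (xa 2) = ![0, 0, -1, 0] := by decide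
  have q3 : quaternionCoord (xa 3) = ![0, 0, 0, 1] := by decide
  simp only [s, map_add, algHomProd, MonoidAlgebra.lift_single]
  refine Prod.ext ?_ ?_
  · funext i
    fin_cases i <;>
      simp [-a_zero, c0, c1, c2, c3, d0, d1, d2, d3] <;> field_simp <;> ring
  · ext <;>
      simp [-a_zero, toQuaternion, p0, p1, p2, p3, q0, q1, q2, q3] <;> field_simp <;> ring

/-- The Wedderburn decomposition of `F[Q₈]` in characteristic different from `2`. -/
theorem nonempty_algEquiv_prod {F : Type*} [Field F] (h2 : (2 : F) ≠ 0) :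
    Nonempty (MonoidAlgebra F (QuaternionGroup 2) ≃ₐ[F] (Fin 4 → F) × ℍ[F,-1,-1]) := by
  refine ⟨AlgEquiv.ofBijective (algHomProd F) ⟨?_, algHomProd_surjective h2⟩⟩
  refine (LinearMap.injective_iff_surjective_of_finrank_eq_finrank
    (f := (algHomProd F).toLinearMap) ?_).2 (algHomProd_surjective h2)
  rw [Module.finrank_prod, QuaternionAlgebra.finrank_eq_four,
    (MonoidAlgebra.coeffLinearEquiv F).finrank_eq]
  simp [QuaternionGroup.card]

/-- The squares in `Q₈` are `1` and `a 2`, so the hypotheses say that `s`, `t`, `st` have order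
four; in particular `t` is not a power of `s`. -/
theorem mem_generators (s t : QuaternionGroup 2) (hs : ∀ y, s ≠ y * y) (ht : ∀ y, t ≠ y * y)
    (hst : ∀ y, s * t ≠ y * y) : s * s = a 2 ∧ t * t = a 2 ∧ t * s = a 2 * (s * t) ∧
      ∀ x, ∃ i : Fin 4, ∃ j : Fin 4, x = s ^ (i : ℕ) * t ^ (j : ℕ) := by
  revert s t; decide

theorem a_two_mem_center : (a 2 : QuaternionGroup 2) ∈ Subgroup.center (QuaternionGroup 2) := by
  rw [Subgroup.mem_center_iff]; decide

end QuaternionGroup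

/-! ### Quaternion generators inside the fixed ring -/

/-- The sign characters of a biquadratic extension take all values. -/
theorem exists_gal_sign_change {F L : Type*} [Field F] [Field L] [Algebra F L]
    [FiniteDimensional F L] [IsGalois F L] (K : IntermediateField F L) (α β : L) (a b : F)
    [IsGalois F K] (hK : IsKleinFour Gal(K/F)) (hadj : K = IntermediateField.adjoin F {α, β})
    (hα : α ^ 2 = algebraMap F L a) (hβ : β ^ 2 = algebraMap F L b) :
    ∃ s t : Gal(L/F), s α = α ∧ s β ≠ β ∧ t α ≠ α ∧ t β = β := by
  classical
  have hαK : α ∈ K := by rw [hadj]; exact IntermediateField.subset_adjoin _ _ (by simp)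
  have hβK : β ∈ K := by rw [hadj]; exact IntermediateField.subset_adjoin _ _ (by simp)
  let α' : K := ⟨α, hαK⟩
  let β' : K := ⟨β, hβK⟩
  have hsign : ∀ (x : K) (r : F), x ^ 2 = algebraMap F K r →
      ∀ σ : Gal(K/F), σ x = x ∨ σ x = -x := fun x r h σ =>
    sq_eq_sq_iff_eq_or_eq_neg.1 (by rw [← map_pow, h, AlgEquiv.commutes])
  have hα' := hsign α' a (Subtype.ext hα)
  have hβ' := hsign β' b (Subtype.ext hβ)
  -- The signs on `α` and `β` determine an automorphism of `K`; since the group has order four,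
  -- every pattern occurs.
  let f : Gal(K/F) → Bool × Bool := fun σ => (decide (σ α' = α'), decide (σ β' = β'))
  have hf : Function.Injective f := by
    intro σ τ h
    obtain ⟨h1, h2⟩ := Prod.ext_iff.1 h
    simp only [f, decide_eq_decide] at h1 h2
    have e1 : σ α' = τ α' := by
      rcases hα' σ with p | p <;> rcases hα' τ with q | q <;> grind
    have e2 : σ β' = τ β' := by
      rcases hβ' σ with p | p <;> rcases hβ' τ with q | q <;> grind
    have e3 : (σ : K →ₐ[F] K) = τ := by
      refine IntermediateField.algHom_ext_of_eq_adjoin F hadj ?_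
      intro x hx
      rcases hx with rfl | rfl
      · exact e1
      · exact e2
    exact AlgEquiv.coe_toAlgHom_injective e3
  have hfin : Fintype Gal(K/F) := Fintype.ofFinite _
  have hsurj := ((Fintype.bijective_iff_injective_and_card f).2
    ⟨hf, by rw [← Nat.card_eq_fintype_card, hK.card_four]; rfl⟩).2
  have hlift : ∀ σ : Gal(K/F), ∃ g : Gal(L/F), ∀ x : K, g x = σ x := fun σ => by
    obtain ⟨g, rfl⟩ := AlgEquiv.restrictNormalHom_surjective (F := F) (K₁ := K) L σ
    exact ⟨g, fun x => (AlgEquiv.restrictNormal_commutes g K x).symm⟩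
  obtain ⟨σ, hσ⟩ := hsurj (true, false)
  obtain ⟨τ, hτ⟩ := hsurj (false, true)
  simp only [f, Prod.mk.injEq, decide_eq_true_eq, decide_eq_false_iff_not] at hσ hτ
  obtain ⟨s, hs⟩ := hlift σ
  obtain ⟨t, ht⟩ := hlift τ
  refine ⟨s, t, ?_, ?_, ?_, ?_⟩
  · rw [hs α', hσ.1]
  · rw [hs β']; exact fun h => hσ.2 (Subtype.ext h)
  · rw [ht α']; exact fun h => hτ.1 (Subtype.ext h)
  · rw [ht β', hτ.2]

/-- The element `γ (1 - z) x` of `L[λ(G)]`. -/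
noncomputable def twistedGenerator {F L : Type*} [Field F] [Field L] [Algebra F L]
    (z x : Gal(L/F)) (γ : L) : MonoidAlgebra L (leftReg Gal(L/F)).range :=
  γ • ((1 - single (leftRegEquiv _ z) 1) * single (leftRegEquiv _ x) 1)

/-- Since `(1 - z)z = -(1 - z)`, the sign on `γ` cancels the factor `z` from conjugating `x`. The
condition is multiplicative in `g`, so generators suffice. -/
theorem twistedGenerator_mem {F L : Type*} [Field F] [Field L] [Algebra F L]
    {z s t x : Gal(L/F)} {γ : L} (hz : z ∈ Subgroup.center Gal(L/F)) (hzz : z * z = 1)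
    (hgen : ∀ g : Gal(L/F), ∃ i j : ℕ, g = s ^ i * t ^ j)
    (hs : s γ = γ ∧ s * x * s⁻¹ = x ∨ s γ = -γ ∧ s * x * s⁻¹ = z * x)
    (ht : t γ = γ ∧ t * x * t⁻¹ = x ∨ t γ = -γ ∧ t * x * t⁻¹ = z * x) :
    twistedGenerator z x γ ∈ lambdaAlgebra F L := by
  have hz' : ∀ g, g * z = z * g := Subgroup.mem_center_iff.1 hz
  let P : Submonoid Gal(L/F) :=
    { carrier := {g | g γ = γ ∧ g * x * g⁻¹ = x ∨ g γ = -γ ∧ g * x * g⁻¹ = z * x}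
      one_mem' := by simp
      mul_mem' := by
        intro g h hg hh
        have e : ∀ y, (g * h) * y * (g * h)⁻¹ = g * (h * y * h⁻¹) * g⁻¹ := fun y => by group
        have e' : g * (z * x) * g⁻¹ = z * (g * x * g⁻¹) := by
          simp only [← mul_assoc, hz']
        rw [Set.mem_ofPred_eq, e, AlgEquiv.mul_apply]
        rcases hg with ⟨g1, g2⟩ | ⟨g1, g2⟩ <;> rcases hh with ⟨h1, h2⟩ | ⟨h1, h2⟩ <;>
          simp [h1, h2, g1, g2, e', ← mul_assoc z z, hzz] }
  rw [mem_fixedGroupAlgebra]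
  intro g
  have hg : g ∈ P := by
    obtain ⟨i, j, rfl⟩ := hgen g
    exact P.mul_mem (P.pow_mem hs i) (P.pow_mem ht j)
  have hzg : g * z * g⁻¹ = z := by rw [hz', mul_inv_cancel_right]
  have hzx : g * (z * x) * g⁻¹ = z * (g * x * g⁻¹) := by simp only [← mul_assoc, hz']
  simp only [twistedGenerator, sub_mul, one_mul, single_mul_single, smul_sub, smul_single, map_sub,
    galAct_single, ← map_mul, conjAct_leftRegEquiv, smul_eq_mul, mul_one, hzx]
  rcases hg with ⟨h1, h2⟩ | ⟨h1, h2⟩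
  · rw [h1, h2]
  · rw [h1, h2, ← mul_assoc, hzz, one_mul, single_neg, single_neg]
    abel

/-- `z` is central and `(1 - z)² = 2(1 - z)`. -/
theorem twistedGenerator_mul {F L : Type*} [Field F] [Field L] [Algebra F L]
    {z : Gal(L/F)} (hz : z ∈ Subgroup.center Gal(L/F)) (hzz : z * z = 1) (x y : Gal(L/F))
    (γ δ : L) : twistedGenerator z x γ * twistedGenerator z y δ =
      twistedGenerator z (x * y) (2 * (γ * δ)) := by
  have hz' : ∀ g, g * z = z * g := Subgroup.mem_center_iff.1 hz
  have e1 : x * (z * y) = z * (x * y) := by rw [← mul_assoc, hz', mul_assoc]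
  have e2 : z * x * y = z * (x * y) := mul_assoc _ _ _
  have e3 : z * x * (z * y) = x * y := by rw [mul_assoc, e1, ← mul_assoc, hzz, one_mul]
  simp only [twistedGenerator, sub_mul, mul_sub, one_mul, single_mul_single, smul_sub, smul_single,
    ← map_mul, smul_eq_mul, mul_one, e1, e2, e3, two_mul, single_add]
  abel

theorem nonempty_quaternion_equiv {F L : Type*} [Field F] [Field L] [Algebra F L]
    [FiniteDimensional F L] [IsGalois F L] (h2 : (2 : F) ≠ 0) (e : Gal(L/F) ≃* QuaternionGroup 2)
    (α β : L) (a b : F) (hα : α ^ 2 = algebraMap F L a) (hβ : β ^ 2 = algebraMap F L b)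
    (s t : Gal(L/F)) (hsα : s α = α) (hsβ : s β ≠ β) (htα : t α ≠ α) (htβ : t β = β) :
    Nonempty (ℍ[F,-a,-b] ≃ₐ[F] ℍ[F,-1,-1]) := by
  have hsign : ∀ (x : L) (r : F), x ^ 2 = algebraMap F L r →
      ∀ σ : Gal(L/F), σ x = x ∨ σ x = -x := fun x r h σ =>
    sq_eq_sq_iff_eq_or_eq_neg.1 (by rw [← map_pow, h, AlgEquiv.commutes])
  have hsq : ∀ (x : L) (r : F), x ^ 2 = algebraMap F L r → ∀ y : Gal(L/F), (y * y) x = x := by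
    intro x r h y
    rcases hsign x r h y with p | p <;> simp [p]
  have hsβ' : s β = -β := (hsign β b hβ s).resolve_left hsβ
  have htα' : t α = -α := (hsign α a hα t).resolve_left htα
  have ha : a ≠ 0 := by
    rintro rfl
    have : α = 0 := by simpa using hα
    exact htα (by simp [this])
  have hb : b ≠ 0 := by
    rintro rfl
    have : β = 0 := by simpa using hβ
    exact hsβ (by simp [this])
  -- Squares in `G` fix `α` and `β`, whereas `s` moves `β`, and `t` and `st` move `α`.
  obtain ⟨hss, htt, hts, hgen⟩ := QuaternionGroup.mem_generators (e s) (e t)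
    (fun y hy => hsβ (by
      rw [show s = e.symm y * e.symm y from e.injective (by simpa using hy)]
      exact hsq β b hβ _))
    (fun y hy => htα (by
      rw [show t = e.symm y * e.symm y from e.injective (by simpa using hy)]
      exact hsq α a hα _))
    (fun y hy => htα (by
      have h1 : (s * t) α = α := by
        rw [show s * t = e.symm y * e.symm y from e.injective (by simpa using hy)]
        exact hsq α a hα _
      rw [AlgEquiv.mul_apply, htα', map_neg, hsα] at h1
      rw [htα', h1]))
  obtain ⟨z, hz2⟩ := e.surjective (.a 2)
  rw [← hz2, ← map_mul] at hss htt
  rw [← hz2, ← map_mul, ← map_mul, ← map_mul] at hts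
  replace hss : s * s = z := e.injective hss
  replace htt : t * t = z := e.injective htt
  replace hts : t * s = z * (s * t) := e.injective hts
  have hgen' : ∀ g : Gal(L/F), ∃ i j : ℕ, g = s ^ i * t ^ j := by
    intro g
    obtain ⟨i, j, h⟩ := hgen (e g)
    exact ⟨i, j, e.injective (by simpa using h)⟩
  have hz : z ∈ Subgroup.center Gal(L/F) := by
    rw [Subgroup.mem_center_iff]
    intro g
    apply e.injective
    rw [map_mul, map_mul, hz2]
    exact Subgroup.mem_center_iff.1 QuaternionGroup.a_two_mem_center _
  have hz' : ∀ g, g * z = z * g := Subgroup.mem_center_iff.1 hz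
  have hzz : z * z = 1 := e.injective (by rw [map_mul, hz2, map_one]; decide)
  have hst : s * t * s⁻¹ = z * t := by
    rw [mul_inv_eq_iff_eq_mul, mul_assoc, hts, ← mul_assoc, hzz, one_mul]
  have hts' : t * s * t⁻¹ = z * s := by
    rw [mul_inv_eq_iff_eq_mul, hts, mul_assoc]
  let u : lambdaAlgebra F L := ⟨twistedGenerator z s α, twistedGenerator_mem hz hzz hgen'
    (.inl ⟨hsα, by simp⟩) (.inr ⟨htα', hts'⟩)⟩
  let v : lambdaAlgebra F L := ⟨twistedGenerator z t β, twistedGenerator_mem hz hzz hgen'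
    (.inr ⟨hsβ', hst⟩) (.inl ⟨htβ, by simp⟩)⟩
  let Z : lambdaAlgebra F L := ⟨single (leftRegEquiv _ z) 1, by
    rw [mem_fixedGroupAlgebra]
    intro g
    rw [galAct_single, conjAct_leftRegEquiv, hz', mul_inv_cancel_right, map_one]⟩
  have hzsq : ∀ r : F, twistedGenerator z z (algebraMap F L r) = r • ((Z : MonoidAlgebra L _) - 1) := by
    intro r
    simp [twistedGenerator, Z, sub_mul, single_mul_single, ← map_mul, hzz, one_def]
  have huu : u * u = (2 * a) • (Z - 1) := by
    apply Subtype.ext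
    change twistedGenerator z s α * twistedGenerator z s α = (2 * a) • ((Z : MonoidAlgebra L _) - 1)
    rw [twistedGenerator_mul hz hzz, hss, ← sq, hα, ← hzsq, map_mul, map_ofNat]
  have hvv : v * v = (2 * b) • (Z - 1) := by
    apply Subtype.ext
    change twistedGenerator z t β * twistedGenerator z t β = (2 * b) • ((Z : MonoidAlgebra L _) - 1)
    rw [twistedGenerator_mul hz hzz, htt, ← sq, hβ, ← hzsq, map_mul, map_ofNat]
  have hvu : v * u = -(u * v) := by
    apply Subtype.ext
    change twistedGenerator z t β * twistedGenerator z s α =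
      -(twistedGenerator z s α * twistedGenerator z t β)
    rw [twistedGenerator_mul hz hzz, twistedGenerator_mul hz hzz, hts, mul_comm β]
    simp [twistedGenerator, sub_mul, single_mul_single, ← map_mul, ← mul_assoc z z, hzz, smul_sub]
  obtain ⟨Φ, c, hΦ⟩ := exists_lambdaAlgebra_equiv (F := F) (L := L)
  -- `z` is central, so conjugation by `c` leaves it alone.
  have hΦZ : Φ Z = single (leftRegEquiv _ z) 1 := by
    apply baseChange_injective (L := L)
    have hcomm : Commute (single (leftRegEquiv _ z) (1 : L)) (c : MonoidAlgebra L _) := by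
      refine commute_single_of_mem_center (Subgroup.mem_center_iff.2 fun n => ?_) _
      obtain ⟨g, rfl⟩ := (leftRegEquiv _).surjective n
      rw [← map_mul, ← map_mul, hz']
    rw [hΦ, baseChange_single, map_one]
    change (c : MonoidAlgebra L _) * single (leftRegEquiv _ z) 1 * _ = _
    rw [← hcomm.eq, mul_assoc, Units.mul_inv, mul_one]
  let Ψ : lambdaAlgebra F L →ₐ[F] ℍ[F,-1,-1] :=
    (MonoidAlgebra.lift F _ _ ((QuaternionGroup.toQuaternion F).comp
      ((leftRegEquiv Gal(L/F)).symm.trans e).toMonoidHom)).comp (Φ : _ →ₐ[F] _)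
  have hΨZ : Ψ Z = -1 := by
    have : QuaternionGroup.quaternionCoord (.a 2) = ![-1, 0, 0, 0] := by decide
    simp only [Ψ, AlgHom.comp_apply, AlgEquiv.coe_toAlgHom, hΦZ, lift_single]
    ext <;> simp [QuaternionGroup.toQuaternion, hz2, this]
  have hΨ : ∀ (w : lambdaAlgebra F L) (r : F), w * w = (2 * r) • (Z - 1) →
      ((2 : F)⁻¹ • Ψ w) * ((2 : F)⁻¹ • Ψ w) = (-r) • 1 := by
    intro w r hw
    rw [smul_mul_smul_comm, ← map_mul, hw, map_smul, map_sub, hΨZ, map_one,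
      show (-1 - 1 : ℍ[F,-1,-1]) = (-2 : F) • 1 by (ext <;> simp); norm_num, smul_smul, smul_smul]
    congr 1
    field_simp
  let B : QuaternionAlgebra.Basis ℍ[F,-1,-1] (-a) 0 (-b) :=
    { i := (2 : F)⁻¹ • Ψ u
      j := (2 : F)⁻¹ • Ψ v
      k := ((2 : F)⁻¹ • Ψ u) * ((2 : F)⁻¹ • Ψ v)
      i_mul_i := by rw [hΨ u a huu, zero_smul, add_zero]
      j_mul_j := hΨ v b hvv
      i_mul_j := rfl
      j_mul_i := by
        rw [smul_mul_smul_comm, smul_mul_smul_comm, ← map_mul, hvu, map_neg, map_mul, zero_smul,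
          zero_sub, smul_neg] }
  exact ⟨QuaternionAlgebra.equivOfAlgHom h2 (neg_ne_zero.2 ha) (neg_ne_zero.2 hb) B.liftHom⟩

theorem mainTheorem10 (F L : Type*) [Field F] [Field L] [Algebra F L]
    [FiniteDimensional F L] [IsGalois F L] (hF : ringChar F ≠ 2)
    (hG : Nonempty (Gal(L/F) ≃* QuaternionGroup 2)) :
    (∀ (K : IntermediateField F L) (α β : L) (a b : F),
      IsGalois F K → IsKleinFour Gal(K/F) →
      K = IntermediateField.adjoin F {α, β} →
      α ^ 2 = algebraMap F L a → β ^ 2 = algebraMap F L b →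
      Nonempty (ℍ[F, -a, -b] ≃ₐ[F] ℍ[F, -1, -1])) ∧
    Nonempty (rhoAlgebra F L ≃ₐ[F] lambdaAlgebra F L) ∧
    Nonempty (lambdaAlgebra F L ≃ₐ[F] (Fin 4 → F) × ℍ[F, -1, -1]) := by
  have h2 : (2 : F) ≠ 0 := Ring.two_ne_zero hF
  obtain ⟨e⟩ := hG
  obtain ⟨Φ, -⟩ := exists_lambdaAlgebra_equiv (F := F) (L := L)
  obtain ⟨R⟩ := nonempty_rhoAlgebra_equiv (F := F) (L := L)
  obtain ⟨W⟩ := QuaternionGroup.nonempty_algEquiv_prod h2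
  refine ⟨?_, ⟨R.trans ((domCongr F F (leftRegEquiv _)).trans Φ.symm)⟩,
    ⟨Φ.trans ((domCongr F F ((leftRegEquiv _).symm.trans e)).trans W)⟩⟩
  intro K α β a b _ hK hadj hα hβ
  obtain ⟨s, t, h1, h3, h4, h5⟩ := exists_gal_sign_change K α β a b hK hadj hα hβ
  exact nonempty_quaternion_equiv h2 e α β a b hα hβ s t h1 h3 h4 h5
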